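/- Let $\mathscr{X}$ be a finite non-empty set, $\mathscr{X}^\ast=\bigcup_{n\ge 0}\mathscr{X}^n$ the set of situations (finite strings), $\Omega=\mathscr{X}^{\mathbb N}$ the set of paths, $\omega^n$ the string of the first $n$ states of $\omega\in\Omega$, and $\Gamma(s)$ the set of all paths that have $s\in\mathscr{X}^\ast$ as an initial segment. A function with values in $\overline{\mathbb R}=\mathbb R\cup\{\pm\infty\}$ is called bounded below if it is $\geq c$ for some real $c$. An upper expectation on a non-empty set $\mathscr{Y}$ is a map $\overline{\mathrm E}\colon\overline{\mathbb R}^{\mathscr Y}\to\overline{\mathbb R}$ such that, for all bounded below $f,g\colon\mathscr{Y}\to\overline{\mathbb R}$, all real $c$ and all real $\lambda>0$: $\overline{\mathrm E}(c)=c$; $\overline{\mathrm E}(f+g)\le\overline{\mathrm E}(f)+\overline{\mathrm E}(g)$; $\overline{\mathrm E}(\lambda f)=\lambda\overline{\mathrm E}(f)$; $f\le g$ implies $\overline{\mathrm E}(f)\le\overline{\mathrm E}(g)$; and $\lim_n\overline{\mathrm E}(f_n)=\overline{\mathrm E}(\lim_n f_n)$ for every non-decreasing sequence $(f_n)$ of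 non-negative functions $\mathscr{Y}\to\overline{\mathbb R}$. Let an imprecise probabilities tree be given, that is, an upper expectation $\overline{\mathrm Q}_s$ on $\mathscr{X}$ for every $s\in\mathscr{X}^\ast$. A supermartingale is a map $\mathscr{M}\colon\mathscr{X}^\ast\to\overline{\mathbb R}$ such that $\overline{\mathrm Q}_s(\mathscr{M}(s\,\cdot))\le\mathscr{M}(s)$ for all $s\in\mathscr{X}^\ast$, where $\mathscr{M}(s\,\cdot)$ is the function $x\mapsto\mathscr{M}(sx)$ on $\mathscr{X}$. Let $\overline{\mathbb M}_{\mathrm b}$ be the set of all bounded below supermartingales, and write $\liminf\mathscr{M}(\omega)=\liminf_{n\to\infty}\mathscr{M}(\omega^n)$. For $f\colon\Omega\to\overline{\mathbb R}$ and $s\in\mathscr{X}^\ast$, the game-theoretic upper expectation is $$\overline{\mathrm E}_{\mathrm V}(f\vert s)=\inf\{\mathscr{M}(s)\colon\mathscr{M}\in\overline{\mathbb M}_{\mathrm b},\ \liminf\mathscr{M}(\omega)\ge f(\omega)\text{ for all }\omega\in\Gamma(s)\}.$$ An event $A\subseteq\Omega$ is strictly almost sure within $\Gamma(s)$ if there is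 a non-negative supermartingale $\mathscr{M}$ with $\mathscr{M}(s)=1$ such that $\lim_n\mathscr{M}(\omega^n)=+\infty$ for all $\omega\in\Gamma(s)\setminus A$. We write $\liminf\mathscr{M}\ge_s f$ s.a.s. if the event $\{\omega\in\Omega\colon\liminf\mathscr{M}(\omega)\ge f(\omega)\}$ is strictly almost sure within $\Gamma(s)$. Then: (i) For every $f\colon\Omega\to\overline{\mathbb R}$ and every $s\in\mathscr{X}^\ast$, $$\overline{\mathrm E}_{\mathrm V}(f\vert s)=\inf\{\mathscr{M}(s)\colon\mathscr{M}\in\overline{\mathbb M}_{\mathrm b},\ \liminf\mathscr{M}\ge_s f\text{ s.a.s.}\}.$$ (ii) If moreover $f$ is bounded below, then for every $s\in\mathscr{X}^\ast$ the infimum in (i) is attained, namely by the process $\mathscr{P}\colon t\mapsto\overline{\mathrm E}_{\mathrm V}(f\vert t)$: this $\mathscr{P}$ (which does not depend on $s$) is a bounded below supermartingale, and $\liminf\mathscr{P}\ge_s f$ s.a.s. for every $s\in\mathscr{X}^\ast$. -/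

import Mathlib

open Filter Topology

noncomputable section

namespace GameUpperExpectation

/-- An extended real variable (or process) is bounded below when it is bounded below by a
real number. -/
def IsBddBelow {Y : Type*} (f : Y → EReal) : Prop :=
  ∃ c : ℝ, ∀ y, (c : EReal) ≤ f y

/-- Upper expectations on the set of all extended real variables on `Y`. The sums and products
below only involve values different from `⊥` and positive real factors, so that no
convention about `⊤ + ⊥` plays a role. -/
structure IsUpperExpectation {Y : Type*} (E : (Y → EReal) → EReal) : Prop where
  const : ∀ c : ℝ, E (fun _ => (c : EReal)) = (c : EReal)
  add_le : ∀ f g : Y → EReal, IsBddBelow f → IsBddBelow g →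
    E (fun y => f y + g y) ≤ E f + E g
  smul : ∀ (c : ℝ) (f : Y → EReal), 0 < c → IsBddBelow f →
    E (fun y => (c : EReal) * f y) = (c : EReal) * E f
  mono : ∀ f g : Y → EReal, IsBddBelow f → IsBddBelow g → (∀ y, f y ≤ g y) → E f ≤ E g
  tendsto : ∀ (f : ℕ → Y → EReal) (g : Y → EReal), Monotone f → (∀ n y, 0 ≤ f n y) →
    (∀ y, Tendsto (fun n => f n y) atTop (𝓝 (g y))) →
    Tendsto (fun n => E (f n)) atTop (𝓝 (E g))

/-- An imprecise probabilities tree on the state space `X`: a local upper expectation for every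
situation. Situations are finite strings of states, `[]` is the initial situation, and
`s ++ [x]` is the situation `s` followed by the state `x`. -/
structure ImpreciseTree (X : Type*) where
  loc : List X → (X → EReal) → EReal
  isUpperExpectation : ∀ s, IsUpperExpectation (loc s)

/-- The situation formed by the first `n` states of the path `ω`
(the `n`-th state of the path is `ω (n - 1)`). -/
def initSeg {X : Type*} (ω : ℕ → X) (n : ℕ) : List X :=
  (List.range n).map ω

/-- The cylinder event: the set of all paths through the situation `s`. -/
def cylinder {X : Type*} (s : List X) : Set (ℕ → X) :=
  {ω | initSeg ω s.length = s}

/-- The pathwise limit inferior of a process. -/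
def liminfProcess {X : Type*} (M : List X → EReal) (ω : ℕ → X) : EReal :=
  liminf (fun n => M (initSeg ω n)) atTop

/-- Supermartingales of an imprecise probabilities tree. -/
def IsSupermartingale {X : Type*} (T : ImpreciseTree X) (M : List X → EReal) : Prop :=
  ∀ s, T.loc s (fun x => M (s ++ [x])) ≤ M s

/-- The set of all bounded below supermartingales. -/
def bddSupermartingales {X : Type*} (T : ImpreciseTree X) : Set (List X → EReal) :=
  {M | IsSupermartingale T M ∧ IsBddBelow M}

/-- The global game-theoretic upper expectation of `f` conditional on the situation `s`. -/
def upperExp {X : Type*} (T : ImpreciseTree X) (f : (ℕ → X) → EReal) (s : List X) : EReal :=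
  sInf {a | ∃ M ∈ bddSupermartingales T,
    (∀ ω ∈ cylinder s, f ω ≤ liminfProcess M ω) ∧ M s = a}

/-- `s`-test supermartingales: non-negative supermartingales with value `1` in `s`. -/
def IsTestSupermartingale {X : Type*} (T : ImpreciseTree X) (s : List X)
    (M : List X → EReal) : Prop :=
  M ∈ bddSupermartingales T ∧ (∀ t, 0 ≤ M t) ∧ M s = 1

/-- The event `A` is strictly almost sure within the cylinder event of `s`. -/
def StrictlyAlmostSure {X : Type*} (T : ImpreciseTree X) (s : List X)
    (A : Set (ℕ → X)) : Prop :=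
  ∃ M, IsTestSupermartingale T s M ∧
    ∀ ω ∈ cylinder s \ A, Tendsto (fun n => M (initSeg ω n)) atTop (𝓝 ⊤)

/-- The values in `s` of the bounded below supermartingales whose limit inferior dominates `f`
strictly almost surely within the cylinder event of `s`. -/
def sasHedgingValues {X : Type*} (T : ImpreciseTree X) (f : (ℕ → X) → EReal) (s : List X) :
    Set EReal :=
  {a | ∃ M ∈ bddSupermartingales T,
    StrictlyAlmostSure T s {ω | f ω ≤ liminfProcess M ω} ∧ M s = a}

end GameUpperExpectation

end

namespace GameUpperExpectation

variable {X : Type*}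

/-! For (i), let `M` dominate `f` strictly almost surely and let `N` be the witnessing test
supermartingale. For each `ε > 0`, `M + ε * N` dominates `f` on every path through `s` and has value
`M s + ε` there.

For (ii), write `P t` for `upperExp T f t`. Any hedge from `s` is also a hedge from `s ++ [x]`, so
`P` is a supermartingale. Domination is a Lévy-type argument. If it fails on a path and `c ≤ f`,
there are rationals `c < a < b` with `b < f ω` and `P < a` infinitely often. Whenever `P t < a`,
some `M` hedging `f` has `M t < a`; it stays above `c` beyond `t` and eventually exceeds `b` on such
paths. Betting along `M - c` thus multiplies capital by `(b - c) / (a - c) > 1`, and the bet can be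
renewed at a later situation with `P < a` (`HedgeableWith.crossing_step`). So any positive capital
can be turned into `1` on a crossing event (`hedgeableWith_crossingEvent`), and a weighted countable
sum of these strategies diverges on all of them (`strictlyAlmostSure_of_hedgeableWith`). -/

/-! ### Situations and paths -/

theorem initSeg_succ (ω : ℕ → X) (n : ℕ) : initSeg ω (n + 1) = initSeg ω n ++ [ω n] := by
  simp [initSeg, List.range_succ]

@[simp]
theorem length_initSeg (ω : ℕ → X) (n : ℕ) : (initSeg ω n).length = n := by
  simp [initSeg]

theorem take_initSeg (ω : ℕ → X) (k n : ℕ) : (initSeg ω n).take k = initSeg ω (min k n) := by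
  simp [initSeg, ← List.map_take, List.take_range]

theorem prefix_initSeg {ω : ℕ → X} {s : List X} (hω : ω ∈ cylinder s) {n : ℕ}
    (hn : s.length ≤ n) : s <+: initSeg ω n := by
  have h : (initSeg ω n).take s.length = s := by
    rw [take_initSeg, min_eq_left hn]
    exact hω
  rw [← h]
  exact List.take_prefix _ _

theorem cylinder_subset_of_prefix {s t : List X} (h : s <+: t) : cylinder t ⊆ cylinder s := by
  intro ω hω
  have ht : initSeg ω t.length = t := hω
  have : (initSeg ω t.length).take s.length = s := by
    rw [ht]
    exact (List.prefix_iff_eq_take.1 h).symm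
  rwa [take_initSeg, min_eq_left h.length_le] at this

theorem exists_path_extending (next : List X → X) (s : List X) :
    ∃ ω ∈ cylinder s, ∀ n, s.length ≤ n → ω n = next (initSeg ω n) := by
  let g : ℕ → List X := fun n => Nat.rec s (fun _ t => t ++ [next t]) n
  have hg : ∀ n, g (n + 1) = g n ++ [next (g n)] := fun n => rfl
  let ω : ℕ → X := fun n => if h : n < s.length then s[n] else next (g (n - s.length))
  have hs : initSeg ω s.length = s := by
    apply List.ext_getElem
    · simp
    · intro i h₁ h₂
      simp [initSeg, ω, h₂]
  have hseg : ∀ n, initSeg ω (s.length + n) = g n := by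
    intro n
    induction n with
    | zero => exact hs
    | succ n ih =>
      rw [← add_assoc, initSeg_succ, ih, hg]
      simp [ω]
  refine ⟨ω, hs, fun n hn => ?_⟩
  obtain ⟨k, rfl⟩ := Nat.exists_eq_add_of_le hn
  rw [hseg]
  simp [ω]

/-! ### Bounded below supermartingales -/

theorem IsBddBelow.comp {Y Z : Type*} {f : Y → EReal} (hf : IsBddBelow f) (g : Z → Y) :
    IsBddBelow (fun z => f (g z)) :=
  hf.imp fun _ hc z => hc (g z)

theorem isBddBelow_of_nonneg {Y : Type*} {f : Y → EReal} (hf : ∀ y, 0 ≤ f y) : IsBddBelow f :=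
  ⟨0, by simpa using hf⟩

theorem IsBddBelow.add {Y : Type*} {f g : Y → EReal} (hf : IsBddBelow f) (hg : IsBddBelow g) :
    IsBddBelow (fun y => f y + g y) := by
  obtain ⟨a, ha⟩ := hf
  obtain ⟨b, hb⟩ := hg
  exact ⟨a + b, fun y => by rw [EReal.coe_add]; exact add_le_add (ha y) (hb y)⟩

theorem IsBddBelow.const_mul {Y : Type*} {f : Y → EReal} (hf : IsBddBelow f) {c : ℝ}
    (hc : 0 ≤ c) : IsBddBelow (fun y => (c : EReal) * f y) := by
  obtain ⟨a, ha⟩ := hf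
  exact ⟨c * a, fun y => by
    rw [EReal.coe_mul]; exact mul_le_mul_of_nonneg_left (ha y) (EReal.coe_nonneg.2 hc)⟩

theorem isBddBelow_const {Y : Type*} (c : ℝ) : IsBddBelow (fun _ : Y => (c : EReal)) :=
  ⟨c, fun _ => le_rfl⟩

variable {T : ImpreciseTree X} {M N : List X → EReal}

theorem isSupermartingale_const (T : ImpreciseTree X) (c : ℝ) :
    IsSupermartingale T (fun _ => (c : EReal)) :=
  fun s => ((T.isUpperExpectation s).const c).le

theorem IsSupermartingale.add (hM : IsSupermartingale T M) (hN : IsSupermartingale T N)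
    (hMb : IsBddBelow M) (hNb : IsBddBelow N) : IsSupermartingale T (fun t => M t + N t) :=
  fun s => ((T.isUpperExpectation s).add_le _ _ (hMb.comp _) (hNb.comp _)).trans
    (add_le_add (hM s) (hN s))

theorem IsSupermartingale.const_mul (hM : IsSupermartingale T M) (hMb : IsBddBelow M) {c : ℝ}
    (hc : 0 < c) : IsSupermartingale T (fun t => (c : EReal) * M t) :=
  fun s => ((T.isUpperExpectation s).smul c _ hc (hMb.comp _)).le.trans
    (mul_le_mul_of_nonneg_left (hM s) (EReal.coe_nonneg.2 hc.le))

theorem add_mem_bddSupermartingales (hM : M ∈ bddSupermartingales T)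
    (hN : N ∈ bddSupermartingales T) : (fun t => M t + N t) ∈ bddSupermartingales T :=
  ⟨hM.1.add hN.1 hM.2 hN.2, hM.2.add hN.2⟩

theorem const_mul_mem_bddSupermartingales (hM : M ∈ bddSupermartingales T) {c : ℝ}
    (hc : 0 < c) : (fun t => (c : EReal) * M t) ∈ bddSupermartingales T :=
  ⟨hM.1.const_mul hM.2 hc, hM.2.const_mul hc.le⟩

theorem const_mem_bddSupermartingales (T : ImpreciseTree X) (c : ℝ) :
    (fun _ => (c : EReal)) ∈ bddSupermartingales T :=
  ⟨isSupermartingale_const T c, isBddBelow_const c⟩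

open Classical in
/-- The process that agrees with `M` from the situation `s` on and is `⊤` elsewhere. -/
noncomputable def restrictFrom (s : List X) (M : List X → EReal) (t : List X) : EReal :=
  if s <+: t then M t else ⊤

theorem restrictFrom_of_prefix {s t : List X} (h : s <+: t) (M : List X → EReal) :
    restrictFrom s M t = M t := if_pos h

theorem IsSupermartingale.restrictFrom (hM : IsSupermartingale T M) (s : List X) :
    IsSupermartingale T (restrictFrom s M) := by
  intro t
  by_cases h : s <+: t
  · have : (fun x => GameUpperExpectation.restrictFrom s M (t ++ [x])) =
        fun x => M (t ++ [x]) :=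
      funext fun x => restrictFrom_of_prefix (h.trans (List.prefix_append _ _)) M
    rw [this, restrictFrom_of_prefix h]
    exact hM t
  · rw [GameUpperExpectation.restrictFrom, if_neg h]
    exact le_top

theorem le_restrictFrom {s : List X} {c : EReal} (h : ∀ t, s <+: t → c ≤ M t) (t : List X) :
    c ≤ restrictFrom s M t := by
  unfold restrictFrom
  split_ifs with ht
  · exact h t ht
  · exact le_top

/-- Otherwise a real constant above `M s` would lie below all successor values, whose minimum is
attained because `X` is finite. -/
theorem IsSupermartingale.exists_le [Finite X] [Nonempty X] (hM : IsSupermartingale T M)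
    (hMb : IsBddBelow M) (s : List X) : ∃ x, M (s ++ [x]) ≤ M s := by
  obtain ⟨x, hx⟩ := Finite.exists_min fun x => M (s ++ [x])
  refine ⟨x, le_of_not_gt fun hlt => ?_⟩
  obtain ⟨r, hr₁, hr₂⟩ := EReal.lt_iff_exists_real_btwn.1 hlt
  have h := (T.isUpperExpectation s).mono (fun _ => (r : EReal)) _ (isBddBelow_const r)
    (hMb.comp fun x => s ++ [x]) (fun y => hr₂.le.trans (hx y))
  rw [(T.isUpperExpectation s).const] at h
  exact absurd (h.trans (hM s)) hr₁.not_ge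

theorem exists_path_liminf_le [Finite X] [Nonempty X] (hM : M ∈ bddSupermartingales T)
    (s : List X) : ∃ ω ∈ cylinder s, liminfProcess M ω ≤ M s := by
  choose next hnext using hM.1.exists_le hM.2
  obtain ⟨ω, hω, hstep⟩ := exists_path_extending next s
  refine ⟨ω, hω, ?_⟩
  have hle : ∀ n, s.length ≤ n → M (initSeg ω n) ≤ M s := by
    intro n hn
    induction n, hn using Nat.le_induction with
    | base => exact (congrArg M hω).le
    | succ n hn ih =>
      rw [initSeg_succ, hstep n hn]
      exact (hnext _).trans ih
  exact liminf_le_of_frequently_le' ((eventually_ge_atTop s.length).mono hle).frequently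

/-- From `t` there is a path along which `M` never exceeds `M t`. This makes a hedge of `f ≥ c`
bounded below by the same `c` beyond `s`. -/
theorem le_of_le_liminf [Finite X] [Nonempty X] (hM : M ∈ bddSupermartingales T) {s t : List X}
    {c : EReal} (hc : ∀ ω ∈ cylinder s, c ≤ liminfProcess M ω) (hst : s <+: t) : c ≤ M t := by
  obtain ⟨ω, hω, h⟩ := exists_path_liminf_le hM t
  exact (hc ω (cylinder_subset_of_prefix hst hω)).trans h

theorem le_upperExp [Finite X] [Nonempty X] {f : (ℕ → X) → EReal} {c : ℝ}
    (hf : ∀ ω, (c : EReal) ≤ f ω) (s : List X) : (c : EReal) ≤ upperExp T f s := by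
  refine le_sInf ?_
  rintro _ ⟨M, hM, hMf, rfl⟩
  exact le_of_le_liminf hM (fun ω hω => (hf ω).trans (hMf ω hω)) List.prefix_rfl

theorem upperExp_mem_bddSupermartingales [Finite X] [Nonempty X] (T : ImpreciseTree X)
    {f : (ℕ → X) → EReal} (hf : IsBddBelow f) :
    (fun t => upperExp T f t) ∈ bddSupermartingales T := by
  obtain ⟨c, hc⟩ := hf
  have hb : IsBddBelow fun t => upperExp T f t := ⟨c, le_upperExp hc⟩
  refine ⟨fun s => le_sInf ?_, hb⟩
  rintro _ ⟨M, hM, hMf, rfl⟩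
  refine ((T.isUpperExpectation s).mono _ _ (hb.comp _) (hM.2.comp _) fun x => ?_).trans (hM.1 s)
  exact sInf_le ⟨M, hM, fun ω hω =>
    hMf ω (cylinder_subset_of_prefix (List.prefix_append _ _) hω), rfl⟩

/-! ### Strictly almost sure hedging: part (i) -/

theorem strictlyAlmostSure_of_cylinder_subset (T : ImpreciseTree X) {s : List X}
    {A : Set (ℕ → X)} (h : cylinder s ⊆ A) : StrictlyAlmostSure T s A :=
  ⟨fun _ => ((1 : ℝ) : EReal), ⟨const_mem_bddSupermartingales T 1, by simp, by simp⟩,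
    fun _ hω => absurd (h hω.1) hω.2⟩

theorem tendsto_add_top {M N : ℕ → EReal} {c : ℝ} (hM : ∀ n, (c : EReal) ≤ M n)
    (hN : Tendsto N atTop (𝓝 ⊤)) : Tendsto (fun n => M n + N n) atTop (𝓝 ⊤) := by
  rw [EReal.tendsto_nhds_top_iff_real] at hN ⊢
  intro r
  filter_upwards [hN (r - c)] with n hn
  calc (r : EReal) = (c : EReal) + ((r - c : ℝ) : EReal) := by
        rw [← EReal.coe_add]; congr 1; ring
    _ < (c : EReal) + N n := EReal.add_lt_add_left_coe hn c
    _ ≤ M n + N n := by gcongr; exact hM n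

theorem upperExp_le_of_strictlyAlmostSure {f : (ℕ → X) → EReal} {s : List X}
    (hM : M ∈ bddSupermartingales T)
    (h : StrictlyAlmostSure T s {ω | f ω ≤ liminfProcess M ω}) : upperExp T f s ≤ M s := by
  obtain ⟨N, ⟨hN, hN0, hNs⟩, htop⟩ := h
  obtain ⟨c, hc⟩ := hM.2
  refine EReal.le_of_forall_lt_iff_le.1 fun z hz => ?_
  -- The slack `z - y` is the stake placed on the test supermartingale `N`.
  obtain ⟨y, hy₁, hy₂⟩ := EReal.lt_iff_exists_real_btwn.1 hz
  have hε : 0 < z - y := sub_pos.2 (EReal.coe_lt_coe_iff.1 hy₂)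
  have hNε : ∀ t, 0 ≤ ((z - y : ℝ) : EReal) * N t := fun t =>
    mul_nonneg (EReal.coe_nonneg.2 hε.le) (hN0 t)
  calc upperExp T f s ≤ M s + ((z - y : ℝ) : EReal) * N s := by
        refine sInf_le ⟨_, add_mem_bddSupermartingales hM
          (const_mul_mem_bddSupermartingales hN hε), fun ω hω => ?_, rfl⟩
        by_cases hA : f ω ≤ liminfProcess M ω
        · exact hA.trans (liminf_le_liminf (Eventually.of_forall fun n =>
            le_add_of_nonneg_right (hNε _)))
        · have h1 : Tendsto (fun n => ((z - y : ℝ) : EReal) * N (initSeg ω n)) atTop (𝓝 ⊤) := by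
            have h2 := htop ω ⟨hω, hA⟩
            rw [EReal.tendsto_nhds_top_iff_real] at h2 ⊢
            intro r
            filter_upwards [h2 ((r + 1) / (z - y))] with n hn
            calc (r : EReal) < ((r + 1 : ℝ) : EReal) := EReal.coe_lt_coe_iff.2 (lt_add_one r)
              _ = ((z - y : ℝ) : EReal) * (((r + 1) / (z - y) : ℝ) : EReal) := by
                rw [← EReal.coe_mul]; congr 1; field_simp
              _ ≤ _ := mul_le_mul_of_nonneg_left hn.le (EReal.coe_nonneg.2 hε.le)
          have h3 := (tendsto_add_top (fun n => hc (initSeg ω n)) h1).liminf_eq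
          rw [liminfProcess, h3]
          exact le_top
    _ ≤ (y : EReal) + ((z - y : ℝ) : EReal) := by
        rw [hNs, mul_one]
        gcongr
    _ = z := by rw [← EReal.coe_add]; congr 1; ring

theorem upperExp_eq_sInf_sasHedgingValues (T : ImpreciseTree X) (f : (ℕ → X) → EReal)
    (s : List X) : upperExp T f s = sInf (sasHedgingValues T f s) := by
  apply le_antisymm
  · refine le_sInf ?_
    rintro _ ⟨M, hM, hMf, rfl⟩
    exact upperExp_le_of_strictlyAlmostSure hM hMf
  · refine sInf_le_sInf ?_
    rintro _ ⟨M, hM, hMf, rfl⟩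
    exact ⟨M, hM, strictlyAlmostSure_of_cylinder_subset T hMf, rfl⟩

/-! ### Switching between supermartingales at a hitting time -/

open Classical in
/-- The process that follows `W` until a situation in `C` is reached, and from the first such
situation `v` on follows `N v`. -/
noncomputable def switchAt (C : Set (List X)) (W : List X → EReal) (N : List X → List X → EReal)
    (t : List X) : EReal :=
  if h : ∃ k, t.take k ∈ C then N (t.take (Nat.find h)) t else W t

section switchAt

variable {C : Set (List X)} {W : List X → EReal} {N : List X → List X → EReal}

theorem switchAt_of_first {t : List X} {k : ℕ} (hk : t.take k ∈ C)
    (hmin : ∀ j < k, t.take j ∉ C) : switchAt C W N t = N (t.take k) t := by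
  classical
  have h : ∃ k, t.take k ∈ C := ⟨k, hk⟩
  have : Nat.find h = k := (Nat.find_eq_iff h).2 ⟨hk, hmin⟩
  rw [switchAt, dif_pos h, this]

theorem switchAt_of_forall_notMem {t : List X} (h : ∀ k, t.take k ∉ C) :
    switchAt C W N t = W t :=
  dif_neg (not_exists.2 h)

theorem exists_first_take {t : List X} (h : ∃ k, t.take k ∈ C) :
    ∃ k ≤ t.length, t.take k ∈ C ∧ ∀ j < k, t.take j ∉ C := by
  classical
  refine ⟨Nat.find h, ?_, Nat.find_spec h, fun j hj => Nat.find_min h hj⟩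
  obtain ⟨k, hk⟩ := h
  by_cases hkt : k ≤ t.length
  · exact (Nat.find_min' _ hk).trans hkt
  · refine Nat.find_min' _ ?_
    rw [List.take_of_length_le (le_of_not_ge hkt)] at hk
    rwa [List.take_length]

theorem switchAt_append {t u : List X} {k : ℕ} (hkt : k ≤ t.length) (hk : t.take k ∈ C)
    (hmin : ∀ j < k, t.take j ∉ C) : switchAt C W N (t ++ u) = N (t.take k) (t ++ u) := by
  have hk' : ∀ j ≤ k, (t ++ u).take j = t.take j := fun j hj =>
    List.take_append_of_le_length (hj.trans hkt)
  rw [switchAt_of_first (k := k), hk' k le_rfl]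
  · rwa [hk' k le_rfl]
  · intro j hj
    rw [hk' j hj.le]
    exact hmin j hj

theorem switchAt_of_mem {t : List X} (ht : t ∈ C) (hmin : ∀ j < t.length, t.take j ∉ C) :
    switchAt C W N t = N t t := by
  have := switchAt_of_first (W := W) (N := N) (k := t.length) (by simpa using ht) hmin
  rwa [List.take_length] at this

theorem switchAt_le (hle : ∀ v ∈ C, N v v ≤ W v) {t : List X}
    (ht : ∀ k < t.length, t.take k ∉ C) : switchAt C W N t ≤ W t := by
  by_cases h : t ∈ C
  · rw [switchAt_of_mem h ht]
    exact hle t h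
  · refine (switchAt_of_forall_notMem fun k => ?_).le
    rcases lt_or_ge k t.length with hk | hk
    · exact ht k hk
    · rwa [List.take_of_length_le hk]

theorem switchAt_nonneg (hW : ∀ t, 0 ≤ W t) (hN : ∀ v ∈ C, ∀ t, 0 ≤ N v t) (t : List X) :
    0 ≤ switchAt C W N t := by
  classical
  unfold switchAt
  split_ifs with h
  · exact hN _ (Nat.find_spec h) t
  · exact hW t

/-- A switch never raises the capital, by `hle`, so just before it the inequality for `W` survives
by monotonicity; after it the process is a single `N v`. -/
theorem isSupermartingale_switchAt (hW : IsSupermartingale T W) (hW0 : ∀ t, 0 ≤ W t)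
    (hN : ∀ v ∈ C, IsSupermartingale T (N v)) (hN0 : ∀ v ∈ C, ∀ t, 0 ≤ N v t)
    (hle : ∀ v ∈ C, N v v ≤ W v) : IsSupermartingale T (switchAt C W N) := by
  intro t
  by_cases h : ∃ k, t.take k ∈ C
  · obtain ⟨k, hkt, hk, hmin⟩ := exists_first_take h
    have : (fun x => switchAt C W N (t ++ [x])) = fun x => N (t.take k) (t ++ [x]) :=
      funext fun x => switchAt_append hkt hk hmin
    rw [this, switchAt_of_first hk hmin]
    exact hN _ hk t
  · rw [not_exists] at h
    rw [switchAt_of_forall_notMem h]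
    refine ((T.isUpperExpectation t).mono _ _
      (isBddBelow_of_nonneg fun x => switchAt_nonneg hW0 hN0 _)
      (isBddBelow_of_nonneg fun x => hW0 (t ++ [x])) fun x => switchAt_le hle ?_).trans (hW t)
    intro k hk
    rw [List.length_append, List.length_singleton, Nat.lt_succ_iff] at hk
    rw [List.take_append_of_le_length hk]
    exact h k

theorem exists_eventually_switchAt_eq (W : List X → EReal) (N : List X → List X → EReal)
    {ω : ℕ → X} (h : ∃ n, initSeg ω n ∈ C) :
    ∃ m, initSeg ω m ∈ C ∧
      ∀ᶠ n in atTop, switchAt C W N (initSeg ω n) = N (initSeg ω m) (initSeg ω n) := by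
  classical
  refine ⟨Nat.find h, Nat.find_spec h, ?_⟩
  filter_upwards [eventually_ge_atTop (Nat.find h)] with n hn
  have htake : ∀ j ≤ Nat.find h, (initSeg ω n).take j = initSeg ω j := fun j hj => by
    rw [take_initSeg, min_eq_left (hj.trans hn)]
  rw [switchAt_of_first (k := Nat.find h), htake _ le_rfl]
  · rw [htake _ le_rfl]
    exact Nat.find_spec h
  · intro j hj
    rw [htake j hj.le]
    exact Nat.find_min h hj

end switchAt

/-! ### Multiplying capital at crossings -/

/-- Starting in `t` with a capital of at most `δ`, Skeptic can reach a capital of at least `1`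
eventually on all paths in the event `A` that go through `t`, without ever borrowing. -/
def HedgeableWith (T : ImpreciseTree X) (A : Set (ℕ → X)) (t : List X) (δ : ℝ) : Prop :=
  ∃ N : List X → EReal, IsSupermartingale T N ∧ (∀ v, 0 ≤ N v) ∧ N t ≤ δ ∧
    ∀ ω ∈ cylinder t ∩ A, ∀ᶠ n in atTop, 1 ≤ N (initSeg ω n)

theorem initSeg_mem_cylinder (ω : ℕ → X) (n : ℕ) : ω ∈ cylinder (initSeg ω n) := by
  simp [cylinder]

/-- Follow `W` until the first visit to `C` from `t` on; the capital is then at least `δ`, enough to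
finance the hedge from there. -/
theorem hedgeableWith_of_hitting {A : Set (ℕ → X)} {t : List X} {δ ε : ℝ} {C : Set (List X)}
    {W : List X → EReal} (hW : IsSupermartingale T W) (hW0 : ∀ v, t <+: v → 0 ≤ W v)
    (hWt : W t ≤ ε) (hC : ∀ v ∈ C, t <+: v → HedgeableWith T A v δ)
    (hCW : ∀ v ∈ C, t <+: v → (δ : EReal) ≤ W v)
    (hit : ∀ ω ∈ cylinder t ∩ A, ∃ᶠ n in atTop, initSeg ω n ∈ C) :
    HedgeableWith T A t ε := by
  classical
  choose! N hN hN0 hNv hNA using hC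
  let D : Set (List X) := {v | v ∈ C ∧ t <+: v}
  have hle : ∀ v ∈ D, N v v ≤ restrictFrom t W v := fun v hv => by
    rw [restrictFrom_of_prefix hv.2]
    exact (hNv v hv.1 hv.2).trans (hCW v hv.1 hv.2)
  refine ⟨switchAt D (restrictFrom t W) N, isSupermartingale_switchAt (hW.restrictFrom t)
    (le_restrictFrom hW0) (fun v hv => hN v hv.1 hv.2) (fun v hv => hN0 v hv.1 hv.2) hle,
    switchAt_nonneg (le_restrictFrom hW0) (fun v hv => hN0 v hv.1 hv.2), ?_, ?_⟩
  · refine (switchAt_le hle fun k hk hkD => ?_).trans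
      ((restrictFrom_of_prefix List.prefix_rfl W).trans_le hWt)
    -- A proper prefix of `t` cannot extend `t`, so no switch happens before `t`.
    have := hkD.2.length_le
    rw [List.length_take] at this
    omega
  · intro ω hω
    obtain ⟨n, hn, hnt⟩ := ((hit ω hω).and_eventually (eventually_ge_atTop t.length)).exists
    obtain ⟨m, hm, heq⟩ := exists_eventually_switchAt_eq (C := D) (restrictFrom t W) N
      ⟨n, hn, prefix_initSeg hω.1 hnt⟩
    filter_upwards [heq, hNA _ hm.1 hm.2 ω ⟨initSeg_mem_cylinder ω m, hω.2⟩] with k hk h1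
    rwa [hk]

theorem hedgeableWith_one (T : ImpreciseTree X) (A : Set (ℕ → X)) (t : List X) :
    HedgeableWith T A t 1 :=
  ⟨fun _ => ((1 : ℝ) : EReal), isSupermartingale_const T 1, by simp, le_rfl, by simp⟩

/-- The event that `f` exceeds `b` although its conditional upper expectations fall below `a`
infinitely often. -/
def crossingEvent (T : ImpreciseTree X) (f : (ℕ → X) → EReal) (a b : ℝ) : Set (ℕ → X) :=
  {ω | (b : EReal) < f ω ∧ ∃ᶠ n in atTop, upperExp T f (initSeg ω n) < a}

section Crossing

variable [Finite X] [Nonempty X] {f : (ℕ → X) → EReal} {a b c : ℝ}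

theorem HedgeableWith.crossing_step (hc : ∀ ω, (c : EReal) ≤ f ω) (hca : c < a) (hab : a < b)
    {δ : ℝ} (hδ : 0 < δ)
    (h : ∀ v, upperExp T f v < a → HedgeableWith T (crossingEvent T f a b) v δ)
    {t : List X} (ht : upperExp T f t < a) :
    HedgeableWith T (crossingEvent T f a b) t (δ * ((a - c) / (b - c))) := by
  obtain ⟨_, ⟨M, hM, hMf, rfl⟩, hMt⟩ := sInf_lt_iff.1 ht
  have hbc : 0 < b - c := by linarith
  have hmul : 0 < δ / (b - c) := div_pos hδ hbc
  have hmul' : (0 : EReal) ≤ ((δ / (b - c) : ℝ) : EReal) := EReal.coe_nonneg.2 hmul.le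
  have hcoe : ∀ y : ℝ, ((δ / (b - c) : ℝ) : EReal) * ((y : EReal) + ((-c : ℝ) : EReal)) =
      ((δ * ((y - c) / (b - c)) : ℝ) : EReal) := fun y => by
    rw [← EReal.coe_add, ← EReal.coe_mul]
    congr 1
    ring
  -- `M - c`, scaled to be worth `δ` at level `b`; at level `a` it then costs `δ * ((a - c) / (b -
  -- c))`.
  have hW := const_mul_mem_bddSupermartingales
    (add_mem_bddSupermartingales hM (const_mem_bddSupermartingales T (-c))) hmul
  have hMc : ∀ v, t <+: v → (c : EReal) ≤ M v := fun v hv =>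
    le_of_le_liminf hM (fun ω hω => (hc ω).trans (hMf ω hω)) hv
  refine hedgeableWith_of_hitting (δ := δ) (C := {v | upperExp T f v < a ∧ (b : EReal) < M v})
    hW.1 (fun v hv => ?_) ?_ (fun v hv _ => h v hv.1) (fun v hv _ => ?_) ?_
  · refine mul_nonneg hmul' ?_
    calc (0 : EReal) = (c : EReal) + ((-c : ℝ) : EReal) := by rw [← EReal.coe_add]; simp
      _ ≤ M v + ((-c : ℝ) : EReal) := by gcongr; exact hMc v hv
  · rw [← hcoe a]
    exact mul_le_mul_of_nonneg_left (by gcongr) hmul'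
  · calc (δ : EReal) = ((δ * ((b - c) / (b - c)) : ℝ) : EReal) := by rw [div_self hbc.ne', mul_one]
      _ = _ := (hcoe b).symm
      _ ≤ _ := mul_le_mul_of_nonneg_left (by have := hv.2.le; gcongr) hmul'
  · rintro ω ⟨hωt, hbf, hfreq⟩
    exact hfreq.and_eventually (eventually_lt_of_lt_liminf (hbf.trans_le (hMf ω hωt)))

theorem hedgeableWith_crossingEvent (hc : ∀ ω, (c : EReal) ≤ f ω) (hca : c < a) (hab : a < b)
    (s : List X) {δ : ℝ} (hδ : 0 < δ) : HedgeableWith T (crossingEvent T f a b) s δ := by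
  have hbc : 0 < b - c := by linarith
  have hr0 : 0 < (a - c) / (b - c) := div_pos (by linarith) hbc
  have hr1 : (a - c) / (b - c) < 1 := (div_lt_one hbc).2 (by linarith)
  have key : ∀ n : ℕ, ∀ t, upperExp T f t < a →
      HedgeableWith T (crossingEvent T f a b) t (((a - c) / (b - c)) ^ n) := by
    intro n
    induction n with
    | zero => exact fun t _ => by simpa using hedgeableWith_one T _ t
    | succ n ih =>
      intro t ht
      rw [pow_succ]
      exact HedgeableWith.crossing_step hc hca hab (pow_pos hr0 n) ih ht
  obtain ⟨n, hn⟩ := exists_pow_lt_of_lt_one hδ hr1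
  -- Hold the capital constant until the upper expectation first drops below `a`.
  refine hedgeableWith_of_hitting (C := {v | upperExp T f v < a})
    (isSupermartingale_const T (((a - c) / (b - c)) ^ n)) (fun _ _ => ?_)
    (EReal.coe_le_coe_iff.2 hn.le) (fun v hv _ => key n v hv) (fun _ _ _ => le_rfl)
    (fun ω hω => hω.2.2)
  exact EReal.coe_nonneg.2 (pow_pos hr0 n).le

end Crossing

/-! ### Countable sums of strategies -/

theorem monotone_sum_range_of_nonneg {N : ℕ → List X → EReal} (hN0 : ∀ k v, 0 ≤ N k v)
    (v : List X) : Monotone fun n => ∑ k ∈ Finset.range n, N k v :=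
  monotone_nat_of_le_succ fun n => by
    rw [Finset.sum_range_succ]
    exact le_add_of_nonneg_right (hN0 n v)

theorem isSupermartingale_sum {N : ℕ → List X → EReal}
    (hN : ∀ k, IsSupermartingale T (N k)) (hN0 : ∀ k v, 0 ≤ N k v) (n : ℕ) :
    IsSupermartingale T (fun v => ∑ k ∈ Finset.range n, N k v) := by
  induction n with
  | zero => simpa using isSupermartingale_const T 0
  | succ n ih =>
    simp only [Finset.sum_range_succ]
    exact ih.add (hN n) (isBddBelow_of_nonneg fun v => Finset.sum_nonneg fun k _ => hN0 k v)
      (isBddBelow_of_nonneg (hN0 n))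

/-- Continuity of the local models along non-decreasing non-negative sequences passes the inequality
to the limit. -/
theorem isSupermartingale_iSup_sum {N : ℕ → List X → EReal}
    (hN : ∀ k, IsSupermartingale T (N k)) (hN0 : ∀ k v, 0 ≤ N k v) :
    IsSupermartingale T (fun v => ⨆ n, ∑ k ∈ Finset.range n, N k v) := by
  intro t
  have h := (T.isUpperExpectation t).tendsto
    (fun n x => ∑ k ∈ Finset.range n, N k (t ++ [x]))
    (fun x => ⨆ n, ∑ k ∈ Finset.range n, N k (t ++ [x]))
    (fun m n hmn x => monotone_sum_range_of_nonneg hN0 _ hmn)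
    (fun n x => Finset.sum_nonneg fun k _ => hN0 k _)
    (fun x => tendsto_atTop_iSup (monotone_sum_range_of_nonneg hN0 _))
  exact le_of_tendsto' h fun n => (isSupermartingale_sum hN hN0 n t).trans
    (le_iSup (fun n => ∑ k ∈ Finset.range n, N k t) n)

theorem tendsto_iSup_sum_top {N : ℕ → ℕ → EReal} (hN0 : ∀ k n, 0 ≤ N k n)
    (h : ∃ᶠ k in atTop, ∀ᶠ n in atTop, 1 ≤ N k n) :
    Tendsto (fun n => ⨆ m, ∑ k ∈ Finset.range m, N k n) atTop (𝓝 ⊤) := by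
  have hcount : ∀ j : ℕ, ∃ m, ∀ᶠ n in atTop, (j : EReal) ≤ ∑ k ∈ Finset.range m, N k n := by
    intro j
    induction j with
    | zero => exact ⟨0, by simp⟩
    | succ j ih =>
      obtain ⟨m, hm⟩ := ih
      obtain ⟨k, hk, hmk⟩ := (h.and_eventually (eventually_ge_atTop m)).exists
      refine ⟨k + 1, ?_⟩
      filter_upwards [hm, hk] with n hn hkn
      rw [Finset.sum_range_succ, Nat.cast_add, Nat.cast_one]
      refine add_le_add (hn.trans ?_) hkn
      exact Finset.sum_le_sum_of_subset_of_nonneg (Finset.range_mono hmk)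
        fun i _ _ => hN0 i n
  rw [EReal.tendsto_nhds_top_iff_real]
  intro r
  obtain ⟨j, hj⟩ := exists_nat_gt r
  obtain ⟨m, hm⟩ := hcount j
  filter_upwards [hm] with n hn
  calc (r : EReal) < ((j : ℝ) : EReal) := EReal.coe_lt_coe_iff.2 hj
    _ = (j : EReal) := by simp
    _ ≤ _ := hn.trans (le_iSup (fun m => ∑ k ∈ Finset.range m, N k n) m)

/-- The value at `s` is raised to exactly `1`. This is harmless at the parent of `s`, where the
process is set to `⊤`. -/
theorem strictlyAlmostSure_of_nonneg_of_le_one {s : List X} {A : Set (ℕ → X)}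
    (hN : IsSupermartingale T N) (hN0 : ∀ v, 0 ≤ N v) (hNs : N s ≤ 1)
    (htop : ∀ ω ∈ cylinder s \ A, Tendsto (fun n => N (initSeg ω n)) atTop (𝓝 ⊤)) :
    StrictlyAlmostSure T s A := by
  classical
  let R : List X → EReal := fun v => if v = s then 1 else restrictFrom s N v
  have hR0 : ∀ v, 0 ≤ R v := fun v => by
    by_cases hv : v = s
    · simp [R, hv]
    · simpa [R, hv] using le_restrictFrom (fun t _ => hN0 t) v
  have hRs : R s = 1 := by simp [R]
  have hRge : ∀ v, restrictFrom s N v ≤ R v := fun v => by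
    by_cases hv : v = s
    · rw [hv, hRs, restrictFrom_of_prefix List.prefix_rfl]
      exact hNs
    · simp [R, hv]
  refine ⟨R, ⟨⟨fun t => ?_, isBddBelow_of_nonneg hR0⟩, hR0, hRs⟩, fun ω hω => ?_⟩
  · by_cases ht : s <+: t
    · have : (fun x => R (t ++ [x])) = fun x => restrictFrom s N (t ++ [x]) := by
        funext x
        refine if_neg fun h => ?_
        have h1 := congrArg List.length h
        have h2 := ht.length_le
        rw [List.length_append, List.length_singleton] at h1
        omega
      rw [this]
      exact (hN.restrictFrom s t).trans (hRge t)
    · refine le_of_le_of_eq le_top ?_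
      have hts : t ≠ s := fun h => ht (h ▸ List.prefix_rfl)
      simp [R, hts, restrictFrom, ht]
  · refine tendsto_nhds_top_mono (htop ω hω) ?_
    filter_upwards [eventually_ge_atTop s.length] with n hn
    have := hRge (initSeg ω n)
    rwa [restrictFrom_of_prefix (prefix_initSeg hω.1 hn)] at this

theorem strictlyAlmostSure_of_hedgeableWith {ι : Type*} [Countable ι] [Nonempty ι]
    {s : List X} {A : Set (ℕ → X)} {B : ι → Set (ℕ → X)}
    (hB : ∀ i δ, 0 < δ → HedgeableWith T (B i) s δ)
    (hA : ∀ ω ∈ cylinder s \ A, ∃ i, ω ∈ B i) : StrictlyAlmostSure T s A := by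
  -- The factor `ℕ` repeats each `i` infinitely often, so infinitely many summands reach `1` on `B
  -- i`; the budgets `(1 / 2) ^ k / 2` sum to `1`.
  obtain ⟨e, he⟩ := exists_surjective_nat (ι × ℕ)
  choose N hN hN0 hNs hNB using fun k : ℕ =>
    hB (e k).1 ((1 / 2 : ℝ) ^ k / 2) (by positivity)
  refine strictlyAlmostSure_of_nonneg_of_le_one (isSupermartingale_iSup_sum hN hN0)
    (fun v => le_iSup_of_le 0 (by simp)) (iSup_le fun n => ?_) fun ω hω => ?_
  · have hsum : ∑ k ∈ Finset.range n, N k s ≤ ((1 - (1 / 2 : ℝ) ^ n : ℝ) : EReal) := by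
      induction n with
      | zero => simp
      | succ n ih =>
        rw [Finset.sum_range_succ]
        refine (add_le_add ih (hNs n)).trans ?_
        rw [← EReal.coe_add, EReal.coe_le_coe_iff, pow_succ]
        linarith
    refine hsum.trans ?_
    rw [← EReal.coe_one, EReal.coe_le_coe_iff]
    linarith [pow_pos (one_half_pos (α := ℝ)) n]
  · obtain ⟨i, hi⟩ := hA ω hω
    refine tendsto_iSup_sum_top (fun k n => hN0 k _) ?_
    have hinf : {k | (e k).1 = i}.Infinite := by
      refine Set.infinite_of_forall_exists_gt fun m => ?_
      by_contra! hcon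
      have hsub : Set.range (fun j : ℕ => (i, j)) ⊆ e '' Set.Iic m := by
        rintro _ ⟨j, rfl⟩
        obtain ⟨k, hk⟩ := he (i, j)
        exact ⟨k, hcon k (by simp [hk]), hk⟩
      exact Set.infinite_range_of_injective (Prod.mk_right_injective i)
        (((Set.finite_Iic m).image e).subset hsub)
    refine (Nat.frequently_atTop_iff_infinite.2 hinf).mono fun k hk => hNB k ω ⟨hω.1, ?_⟩
    rwa [show (e k).1 = i from hk]

/-! ### Lévy-type domination: part (ii) -/

theorem strictlyAlmostSure_le_liminf_upperExp [Finite X] [Nonempty X] (T : ImpreciseTree X)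
    {f : (ℕ → X) → EReal} (hf : IsBddBelow f) (s : List X) :
    StrictlyAlmostSure T s {ω | f ω ≤ liminfProcess (fun t => upperExp T f t) ω} := by
  obtain ⟨c, hc⟩ := hf
  obtain ⟨a₀, ha₀⟩ := exists_rat_gt c
  obtain ⟨b₀, hb₀⟩ := exists_rat_gt (a₀ : ℝ)
  have : Nonempty {p : ℚ × ℚ // c < p.1 ∧ (p.1 : ℝ) < p.2} := ⟨⟨(a₀, b₀), ha₀, hb₀⟩⟩
  refine strictlyAlmostSure_of_hedgeableWith
    (B := fun p : {p : ℚ × ℚ // c < p.1 ∧ (p.1 : ℝ) < p.2} => crossingEvent T f p.1.1 p.1.2)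
    (fun p δ hδ => hedgeableWith_crossingEvent hc p.2.1 p.2.2 s hδ) fun ω hω => ?_
  have hlt : liminfProcess (fun t => upperExp T f t) ω < f ω := not_le.1 hω.2
  obtain ⟨b, hb₁, hb₂⟩ := EReal.lt_iff_exists_rat_btwn.1 hlt
  obtain ⟨a, ha₁, ha₂⟩ := EReal.lt_iff_exists_rat_btwn.1 hb₁
  have hcl : (c : EReal) ≤ liminfProcess (fun t => upperExp T f t) ω :=
    le_liminf_of_le (h := Eventually.of_forall fun n => le_upperExp hc _)
  exact ⟨⟨(a, b), EReal.coe_lt_coe_iff.1 (hcl.trans_lt ha₁), EReal.coe_lt_coe_iff.1 ha₂⟩, hb₂,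
    frequently_lt_of_liminf_lt (h := ha₁)⟩

end GameUpperExpectation

theorem mainTheorem12 {X : Type*} [Finite X] [Nonempty X]
    (T : GameUpperExpectation.ImpreciseTree X) :
    (∀ (f : (ℕ → X) → EReal) (s : List X),
      GameUpperExpectation.upperExp T f s =
        sInf (GameUpperExpectation.sasHedgingValues T f s)) ∧
    (∀ f : (ℕ → X) → EReal, GameUpperExpectation.IsBddBelow f →
      (fun t => GameUpperExpectation.upperExp T f t) ∈
          GameUpperExpectation.bddSupermartingales T ∧
      ∀ s : List X,
        GameUpperExpectation.StrictlyAlmostSure T s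
          {ω | f ω ≤ GameUpperExpectation.liminfProcess
            (fun t => GameUpperExpectation.upperExp T f t) ω} ∧
        IsLeast (GameUpperExpectation.sasHedgingValues T f s)
          (GameUpperExpectation.upperExp T f s)) := by
  refine ⟨GameUpperExpectation.upperExp_eq_sInf_sasHedgingValues T, fun f hf => ?_⟩
  have hP := GameUpperExpectation.upperExp_mem_bddSupermartingales T hf
  refine ⟨hP, fun s => ?_⟩
  have hs := GameUpperExpectation.strictlyAlmostSure_le_liminf_upperExp T hf s
  refine ⟨hs, ⟨_, hP, hs, rfl⟩, ?_⟩
  rintro _ ⟨M, hM, hMf, rfl⟩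
  exact GameUpperExpectation.upperExp_le_of_strictlyAlmostSure hM hMf
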